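/- Let $\mathcal A=(Q,\Sigma,\Gamma,\delta,Q_0,F)$ be a one-way (non-deterministic) Büchi transducer: $Q,\Sigma,\Gamma$ are finite sets, $Q_0,F\subseteq Q$ are the sets of initial and accepting states, and $\delta\subseteq Q\times\Sigma\times Q\times\Gamma^*$ is a finite transition relation. A run on an $\omega$-word is final if it visits some state of $F$ infinitely often, and accepting if it is final and starts in $Q_0$. Assume that every final run produces an infinite output, that $\mathcal A$ is trim (every state appears in some accepting run), and that $\mathcal A$ is functional, i.e. the relation $\{(x,y)\in\Sigma^\omega\times\Gamma^\omega : y \text{ is the output of an accepting run on } x\}$ is a partial function $f$. For $x,y\in\Sigma^\omega$ (or in $\Gamma^\omega$) let $|x\wedge y|\in\mathbb N\cup\{\infty\}$ be the length of their longest common prefix. The function $f$ is continuous if for all $x\in\mathrm{dom}(f)$ and all $i\ge 0$ there is $j\ge 0$ such that for all $y\in\mathrm{dom}(f)$, $|x\wedge y|\ge j$ implies $|f(x)\wedge f(y)|\ge i$; it is uniformly continuous if for all $i\ge 0$ there is $j\ge 0$ such that for all $x,y\in\mathrm{dom}(f)$, $|x\wedge y|\ge j$ implies $|f(x)\wedge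 f(y)|\ge i$. Write $p\xrightarrow{u|v}q$ if there is a finite run from $p$ to $q$ on input $u\in\Sigma^*$ with output $v\in\Gamma^*$, and say that $\mathrm{mismatch}(u,v)$ holds if there is a position $i\le |u|,|v|$ with $u[i]\ne v[i]$. Then: (1) $f$ is not continuous if and only if $\mathcal A$ satisfies $\phi_{\text{cont}}$: there are states $p_1,q_1,p_2,q_2,r_2$, input words $u,v,w\in\Sigma^*$ with $v\neq\epsilon$, and output words $u_1,v_1,u_2,v_2,w_2\in\Gamma^*$ such that $$p_1\xrightarrow{u|u_1}q_1\xrightarrow{v|v_1}q_1,\qquad p_2\xrightarrow{u|u_2}q_2\xrightarrow{v|v_2}q_2\xrightarrow{w|w_2}r_2,$$ $p_1,p_2\in Q_0$, $q_1\in F$, and $$\mathrm{mismatch}(u_1,u_2)\ \vee\ \big(v_2=\epsilon\wedge\mathrm{mismatch}(u_1,u_2w_2)\big).$$ (2) $f$ is not uniformly continuous if and only if $\mathcal A$ satisfies $\phi_{\text{u-cont}}$: there are states $p_1,q_1,r_1,p_2,q_2,r_2$, input words $u,v,w,w'\in\Sigma^*$ with $v\neq\epsilon$, and output words $u_1,v_1,w_1,u_2,v_2,w_2\in\Gamma^*$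 such that $$p_1\xrightarrow{u|u_1}q_1\xrightarrow{v|v_1}q_1\xrightarrow{w|w_1}r_1,\qquad p_2\xrightarrow{u|u_2}q_2\xrightarrow{v|v_2}q_2\xrightarrow{w'|w_2}r_2,$$ $p_1,p_2\in Q_0$, and $$\mathrm{mismatch}(u_1,u_2)\ \vee\ \big(v_1=\epsilon\wedge\mathrm{mismatch}(u_1w_1,u_2)\big)\ \vee\ \big(v_2=\epsilon\wedge\mathrm{mismatch}(u_1,u_2w_2)\big)\ \vee\ \big(v_1=v_2=\epsilon\wedge\mathrm{mismatch}(u_1w_1,u_2w_2)\big).$$ -/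

import Mathlib

/-- A one-way Büchi transducer with state set `Q`, input alphabet `A` and output alphabet `B`
(all three are assumed finite where transducers are used). A transition `(p, a, q, γ)` goes from
`p` to `q`, reads the letter `a` and produces the finite word `γ`. -/
structure BuchiTransducer (Q A B : Type*) where
  trans : Set (Q × A × Q × List B)
  trans_finite : trans.Finite
  init : Set Q
  acc : Set Q

/-- An infinite sequence of states together with the outputs of the successive transitions. -/
structure InfRun (Q B : Type*) where
  state : ℕ → Q
  out : ℕ → List B

namespace InfRun

variable {Q B : Type*}

/-- The concatenation of the outputs of the first `n` transitions. -/
def outPrefix (ρ : InfRun Q B) (n : ℕ) : List B :=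
  ((List.range n).map ρ.out).flatten

/-- The output of the run (the concatenation of all its outputs) is infinite. -/
def InfiniteOutput (ρ : InfRun Q B) : Prop :=
  ∀ k : ℕ, ∃ n : ℕ, k ≤ (ρ.outPrefix n).length

/-- The output of the run is the infinite word `y`. -/
def HasOutput (ρ : InfRun Q B) (y : ℕ → B) : Prop :=
  ρ.InfiniteOutput ∧
    ∀ (n k : ℕ) (hk : k < (ρ.outPrefix n).length), (ρ.outPrefix n)[k] = y k

end InfRun

/-- The infinite words `x` and `y` have a common prefix of length `n`, i.e. `|x ∧ y| ≥ n`. -/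
def AgreeTo {A : Type*} (n : ℕ) (x y : ℕ → A) : Prop :=
  ∀ k < n, x k = y k

/-- Continuity at a point `x` of the domain of a partial function on infinite words. -/
def OmegaContinuousAt {A B : Type*} (f : (ℕ → A) →. (ℕ → B)) (x : ℕ → A) : Prop :=
  ∀ fx ∈ f x, ∀ i : ℕ, ∃ j : ℕ, ∀ y, ∀ fy ∈ f y, AgreeTo j x y → AgreeTo i fx fy

/-- Continuity of a partial function on infinite words: continuity at each point of its domain. -/
def OmegaContinuous {A B : Type*} (f : (ℕ → A) →. (ℕ → B)) : Prop :=
  ∀ x ∈ f.Dom, OmegaContinuousAt f x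

/-- Uniform continuity of a partial function on infinite words. -/
def OmegaUniformlyContinuous {A B : Type*} (f : (ℕ → A) →. (ℕ → B)) : Prop :=
  ∀ i : ℕ, ∃ j : ℕ, ∀ x y, ∀ fx ∈ f x, ∀ fy ∈ f y, AgreeTo j x y → AgreeTo i fx fy

/-- Two finite words differ at some position that exists in both. -/
def Mismatch {B : Type*} (u v : List B) : Prop :=
  ∃ (i : ℕ) (hu : i < u.length) (hv : i < v.length), u[i] ≠ v[i]

namespace BuchiTransducer

variable {Q A B : Type*}

/-- `ρ` is a run on the infinite word `x`, from an arbitrary state. -/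
def IsRun (T : BuchiTransducer Q A B) (x : ℕ → A) (ρ : InfRun Q B) : Prop :=
  ∀ i : ℕ, (ρ.state i, x i, ρ.state (i + 1), ρ.out i) ∈ T.trans

/-- `ρ` is a final run on `x`: some accepting state is visited infinitely often. -/
def IsFinalRun (T : BuchiTransducer Q A B) (x : ℕ → A) (ρ : InfRun Q B) : Prop :=
  T.IsRun x ρ ∧ ∃ q ∈ T.acc, ∃ᶠ i in Filter.atTop, ρ.state i = q

/-- `ρ` is an accepting run on `x`: a final run from an initial state. -/
def IsAcceptingRun (T : BuchiTransducer Q A B) (x : ℕ → A) (ρ : InfRun Q B) : Prop :=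
  T.IsFinalRun x ρ ∧ ρ.state 0 ∈ T.init

/-- Every final run produces an infinite word. -/
def FinalRunsProduceInfinite (T : BuchiTransducer Q A B) : Prop :=
  ∀ x ρ, T.IsFinalRun x ρ → ρ.InfiniteOutput

/-- Every state appears in some accepting run. -/
def Trim (T : BuchiTransducer Q A B) : Prop :=
  ∀ q : Q, ∃ x ρ, T.IsAcceptingRun x ρ ∧ ∃ i : ℕ, ρ.state i = q

/-- The relation on infinite words computed by the transducer. -/
def Rel (T : BuchiTransducer Q A B) (x : ℕ → A) (y : ℕ → B) : Prop :=
  ∃ ρ, T.IsAcceptingRun x ρ ∧ ρ.HasOutput y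

/-- The relation computed by the transducer is a (partial) function. -/
def Functional (T : BuchiTransducer Q A B) : Prop :=
  ∀ x y y', T.Rel x y → T.Rel x y' → y = y'

/-- The partial function defined by a functional transducer. -/
noncomputable def toFun (T : BuchiTransducer Q A B) : (ℕ → A) →. (ℕ → B) :=
  fun x => ⟨∃ y, T.Rel x y, fun h => Classical.choose h⟩

theorem mem_toFun_iff (T : BuchiTransducer Q A B) (hT : T.Functional) (x : ℕ → A) (y : ℕ → B) :
    y ∈ T.toFun x ↔ T.Rel x y := by
  constructor
  · rintro ⟨h, rfl⟩
    exact Classical.choose_spec h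
  · intro h
    exact ⟨⟨y, h⟩, hT _ _ _ (Classical.choose_spec (⟨y, h⟩ : ∃ y, T.Rel x y)) h⟩

/-- `T.FinRun p u v q`: there is a finite run from `p` to `q` on the input `u` with output `v`. -/
inductive FinRun (T : BuchiTransducer Q A B) : Q → List A → List B → Q → Prop
  | nil (q : Q) : FinRun T q [] [] q
  | cons {p q r : Q} {a : A} {γ : List B} {u : List A} {v : List B}
      (h : (p, a, q, γ) ∈ T.trans) (t : FinRun T q u v r) : FinRun T p (a :: u) (γ ++ v) r

/-- The pattern for non-continuity. The common loop is over a nonempty input word `v`. -/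
def PatternCont (T : BuchiTransducer Q A B) : Prop :=
  ∃ (p₁ q₁ p₂ q₂ r₂ : Q) (u v w : List A) (u₁ v₁ u₂ v₂ w₂ : List B),
    T.FinRun p₁ u u₁ q₁ ∧ T.FinRun q₁ v v₁ q₁ ∧
    T.FinRun p₂ u u₂ q₂ ∧ T.FinRun q₂ v v₂ q₂ ∧ T.FinRun q₂ w w₂ r₂ ∧
    v ≠ [] ∧
    (p₁ ∈ T.init ∧ p₂ ∈ T.init ∧ q₁ ∈ T.acc) ∧
    (Mismatch u₁ u₂ ∨ (v₂ = [] ∧ Mismatch u₁ (u₂ ++ w₂)))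

/-- The pattern for non-uniform-continuity. The common loop is over a nonempty input word `v`. -/
def PatternUCont (T : BuchiTransducer Q A B) : Prop :=
  ∃ (p₁ q₁ r₁ p₂ q₂ r₂ : Q) (u v w w' : List A) (u₁ v₁ w₁ u₂ v₂ w₂ : List B),
    T.FinRun p₁ u u₁ q₁ ∧ T.FinRun q₁ v v₁ q₁ ∧ T.FinRun q₁ w w₁ r₁ ∧
    T.FinRun p₂ u u₂ q₂ ∧ T.FinRun q₂ v v₂ q₂ ∧ T.FinRun q₂ w' w₂ r₂ ∧
    v ≠ [] ∧
    (p₁ ∈ T.init ∧ p₂ ∈ T.init) ∧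
    (Mismatch u₁ u₂ ∨
      (v₁ = [] ∧ Mismatch (u₁ ++ w₁) u₂) ∨
      (v₂ = [] ∧ Mismatch u₁ (u₂ ++ w₂)) ∨
      (v₁ = [] ∧ v₂ = [] ∧ Mismatch (u₁ ++ w₁) (u₂ ++ w₂)))

end BuchiTransducer

/-! The loop of a pattern can be pumped, and conversely pigeonhole finds a loop in any failure of
continuity. If a pattern holds, repeating the loop `n` times gives inputs with an arbitrarily long
common prefix, while the mismatch survives: it lies in the output before the loop, or past a loop
that outputs nothing. Trimness completes finite runs to accepting ones; in `PatternCont` the loop at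
an accepting state, repeated forever, puts the limit input in the domain.

Conversely, suppose that images of arbitrarily close inputs differ within `i` letters. States
together with output lengths capped at `i` take finitely many values, so some value repeats inside
the common prefix (`exists_bound_repetition`). The repeated state closes a loop; the repeated capped
length means that `i` letters are already out or that the loop outputs nothing
(`InfRun.le_length_or_outSegment_eq_nil`). These alternatives are the disjuncts of the pattern. -/

/-! ### Prefixes and mismatches -/

/-- The finite word `u` is a prefix of the infinite word `x`. -/
def StartsWith {A : Type*} (u : List A) (x : ℕ → A) : Prop :=
  ∀ (k : ℕ) (hk : k < u.length), u[k] = x k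

theorem startsWith_append {A : Type*} {u v : List A} {x : ℕ → A} :
    StartsWith (u ++ v) x ↔ StartsWith u x ∧ StartsWith v (fun k => x (k + u.length)) := by
  constructor
  · intro h
    refine ⟨fun k hk => ?_, fun k hk => ?_⟩
    · rw [← h k (by simp; omega), List.getElem_append_left]
    · beta_reduce
      rw [← h (k + u.length) (by simp; omega), List.getElem_append_right (by omega)]
      simp
  · rintro ⟨hu, hv⟩ k hk
    by_cases hku : k < u.length
    · rw [List.getElem_append_left hku, hu]
    · have hk' : k - u.length < v.length := by simp at hk; omega
      rw [List.getElem_append_right (by omega), hv _ hk']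
      simp only [Nat.sub_add_cancel (not_lt.mp hku)]

theorem startsWith_flatten_replicate {A : Type*} {v : List A} {x : ℕ → A} (hv : StartsWith v x)
    (hx : ∀ k, x (k + v.length) = x k) (n : ℕ) : StartsWith (List.replicate n v).flatten x := by
  induction n with
  | zero => intro k hk; simp at hk
  | succ n ih =>
    rw [List.replicate_succ, List.flatten_cons, startsWith_append]
    exact ⟨hv, by simpa only [hx] using ih⟩

/-- Infinite words that extend a common finite word agree up to its length. -/
theorem StartsWith.agreeTo {A : Type*} {u : List A} {x y : ℕ → A} (hx : StartsWith u x)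
    (hy : StartsWith u y) {n : ℕ} (hn : n ≤ u.length) : AgreeTo n x y :=
  fun k hk => (hx k (by omega)).symm.trans (hy k (by omega))

/-- Infinite words that extend mismatching finite words disagree. -/
theorem Mismatch.not_agreeTo {B : Type*} {u v : List B} {x y : ℕ → B} (h : Mismatch u v)
    (hx : StartsWith u x) (hy : StartsWith v y) : ¬ AgreeTo u.length x y := by
  obtain ⟨i, hu, hv, hne⟩ := h
  intro hxy
  exact hne (by rw [hx, hy, hxy i hu])

/-- Long enough prefixes of infinite words that disagree are mismatching. -/
theorem mismatch_of_not_agreeTo {B : Type*} {u v : List B} {x y : ℕ → B} {n : ℕ}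
    (h : ¬ AgreeTo n x y) (hx : StartsWith u x) (hy : StartsWith v y) (hu : n ≤ u.length)
    (hv : n ≤ v.length) : Mismatch u v := by
  unfold AgreeTo at h
  push Not at h
  obtain ⟨k, hk, hne⟩ := h
  exact ⟨k, by omega, by omega, by rwa [hx, hy]⟩

/-! ### Outputs of infinite runs -/

namespace InfRun

variable {Q B : Type*}

/-- The concatenation of the outputs of `l` successive transitions, from the `m`-th one on. -/
def outSegment (ρ : InfRun Q B) (m l : ℕ) : List B :=
  ((List.range' m l).map ρ.out).flatten

theorem outPrefix_add (ρ : InfRun Q B) (m l : ℕ) :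
    ρ.outPrefix (m + l) = ρ.outPrefix m ++ ρ.outSegment m l := by
  have h := List.range'_append_1 (s := 0) (m := m) (n := l)
  rw [Nat.zero_add] at h
  rw [outPrefix, outPrefix, outSegment, List.range_eq_range', List.range_eq_range', ← h,
    List.map_append, List.flatten_append]

theorem outPrefix_eq_outSegment (ρ : InfRun Q B) (n : ℕ) : ρ.outPrefix n = ρ.outSegment 0 n := by
  simp [outPrefix, outSegment, List.range_eq_range']

theorem outPrefix_isPrefix (ρ : InfRun Q B) {m n : ℕ} (h : m ≤ n) :
    ρ.outPrefix m <+: ρ.outPrefix n := by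
  obtain ⟨l, rfl⟩ := Nat.exists_eq_add_of_le h
  exact ⟨_, (ρ.outPrefix_add m l).symm⟩

theorem HasOutput.startsWith {ρ : InfRun Q B} {y : ℕ → B} (h : ρ.HasOutput y) (n : ℕ) :
    StartsWith (ρ.outPrefix n) y :=
  fun k hk => h.2 n k hk

/-- The output prefixes are nested, so a letter does not depend on the prefix it is read from. -/
theorem InfiniteOutput.exists_hasOutput {ρ : InfRun Q B} (h : ρ.InfiniteOutput) :
    ∃ y, ρ.HasOutput y := by
  choose n hn using fun k => h (k + 1)
  refine ⟨fun k => (ρ.outPrefix (n k))[k]'(hn k), h, fun m k hk => ?_⟩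
  rcases le_total m (n k) with hm | hm
  · exact (ρ.outPrefix_isPrefix hm).getElem hk
  · exact ((ρ.outPrefix_isPrefix hm).getElem (hn k)).symm

/-- A run with infinite output produces arbitrarily long outputs by extending any finite part. -/
theorem InfiniteOutput.exists_outSegment {ρ : InfRun Q B} (h : ρ.InfiniteOutput) (m k : ℕ) :
    ∃ l, k ≤ (ρ.outPrefix m ++ ρ.outSegment m l).length := by
  obtain ⟨n, hn⟩ := h k
  refine ⟨n, hn.trans ?_⟩
  rw [← outPrefix_add]
  exact (ρ.outPrefix_isPrefix (by omega)).length_le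

/-- Prepend a transition to a run. -/
def cons (p : Q) (γ : List B) (ρ : InfRun Q B) : InfRun Q B where
  state n := Nat.casesOn n p ρ.state
  out n := Nat.casesOn n γ ρ.out

theorem outPrefix_cons (p : Q) (γ : List B) (ρ : InfRun Q B) (n : ℕ) :
    (ρ.cons p γ).outPrefix (n + 1) = γ ++ ρ.outPrefix n := by
  simp [outPrefix, cons, List.range_succ_eq_map, Function.comp_def]

end InfRun

/-! ### Gluing, cutting and looping runs -/

namespace BuchiTransducer

variable {Q A B : Type*} {T : BuchiTransducer Q A B}

theorem FinRun.append {p q r : Q} {u u' : List A} {v v' : List B} (h : T.FinRun p u v q)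
    (h' : T.FinRun q u' v' r) : T.FinRun p (u ++ u') (v ++ v') r := by
  induction h with
  | nil => exact h'
  | cons hpq _ ih => rw [List.cons_append, List.append_assoc]; exact .cons hpq (ih h')

theorem FinRun.iterate {q : Q} {u : List A} {v : List B} (h : T.FinRun q u v q) (n : ℕ) :
    T.FinRun q (List.replicate n u).flatten (List.replicate n v).flatten q := by
  induction n with
  | zero => exact .nil q
  | succ n ih => simpa only [List.replicate_succ, List.flatten_cons] using h.append ih

/-- The part of an infinite run between two positions is a finite run. -/
theorem IsRun.finRun {x : ℕ → A} {ρ : InfRun Q B} (h : T.IsRun x ρ) (m l : ℕ) :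
    T.FinRun (ρ.state m) ((List.range' m l).map x) (ρ.outSegment m l) (ρ.state (m + l)) := by
  induction l generalizing m with
  | zero => exact .nil _
  | succ l ih =>
    have := ih (m + 1)
    rw [show m + 1 + l = m + (l + 1) by omega] at this
    simpa [InfRun.outSegment, List.range'_succ] using FinRun.cons (h m) this

theorem IsFinalRun.cons {p : Q} {a : A} {γ : List B} {x : ℕ → A} {ρ : InfRun Q B}
    (hp : (p, a, ρ.state 0, γ) ∈ T.trans) (h : T.IsFinalRun x ρ) :
    T.IsFinalRun (fun n => Nat.casesOn n a x) (ρ.cons p γ) := by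
  obtain ⟨hrun, q, hq, hfreq⟩ := h
  refine ⟨?_, q, hq, ?_⟩
  · rintro (_ | i)
    · exact hp
    · exact hrun i
  · rw [Filter.frequently_atTop] at hfreq ⊢
    intro n
    obtain ⟨k, hk, hkq⟩ := hfreq n
    exact ⟨k + 1, by omega, hkq⟩

/-- Prepend a finite run to a final run. -/
theorem FinRun.exists_isFinalRun {p q : Q} {u : List A} {v : List B} (h : T.FinRun p u v q)
    {x : ℕ → A} {ρ : InfRun Q B} (hρ : T.IsFinalRun x ρ) (hq : ρ.state 0 = q) :
    ∃ x' ρ', T.IsFinalRun x' ρ' ∧ ρ'.state 0 = p ∧ ρ'.outPrefix u.length = v ∧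
      StartsWith u x' ∧ ∀ k, x' (k + u.length) = x k := by
  induction h with
  | nil => exact ⟨x, ρ, hρ, hq, rfl, fun k hk => by simp at hk, fun k => rfl⟩
  | @cons p _ _ a γ u v hpq _ ih =>
    obtain ⟨x', ρ', hρ', hs, ho, hu, hx⟩ := ih hq
    subst hs
    refine ⟨_, _, hρ'.cons hpq, rfl, ?_, ?_, fun k => hx k⟩
    · rw [List.length_cons, InfRun.outPrefix_cons, ho]
    · rintro (_ | k) hk
      · rfl
      · exact hu k (by simpa using hk)

/-- A suffix of an accepting run still visits its accepting state infinitely often. -/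
theorem Trim.exists_isFinalRun (hT : T.Trim) (q : Q) :
    ∃ x ρ, T.IsFinalRun x ρ ∧ ρ.state 0 = q := by
  obtain ⟨x, ρ, ⟨⟨hrun, r, hr, hfreq⟩, -⟩, i, hi⟩ := hT q
  refine ⟨fun n => x (i + n), ⟨fun n => ρ.state (i + n), fun n => ρ.out (i + n)⟩,
    ⟨fun n => hrun (i + n), r, hr, ?_⟩, hi⟩
  rw [Filter.frequently_atTop] at hfreq ⊢
  intro n
  obtain ⟨k, hk, hkr⟩ := hfreq (i + n)
  exact ⟨k - i, by omega, by simpa [show i + (k - i) = k by omega] using hkr⟩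

/-- A finite run from an initial state, followed by a final run, yields a pair of the relation. -/
theorem FinRun.exists_rel (hinf : T.FinalRunsProduceInfinite) {p q : Q} {u : List A} {v : List B}
    (h : T.FinRun p u v q) (hp : p ∈ T.init) {x : ℕ → A} {ρ : InfRun Q B}
    (hρ : T.IsFinalRun x ρ) (hq : ρ.state 0 = q) :
    ∃ x' y, T.Rel x' y ∧ StartsWith u x' ∧ StartsWith v y ∧ ∀ k, x' (k + u.length) = x k := by
  obtain ⟨x', ρ', hρ', hs, ho, hu, hx⟩ := h.exists_isFinalRun hρ hq
  obtain ⟨y, hy⟩ := (hinf x' ρ' hρ').exists_hasOutput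
  exact ⟨x', y, ⟨ρ', ⟨hρ', hs ▸ hp⟩, hy⟩, hu, ho ▸ hy.startsWith _, hx⟩

/-- In a trim transducer, finite runs from initial states extend to pairs of the relation. -/
theorem Trim.exists_rel (hT : T.Trim) (hinf : T.FinalRunsProduceInfinite) {p q : Q} {u : List A}
    {v : List B} (h : T.FinRun p u v q) (hp : p ∈ T.init) :
    ∃ x y, T.Rel x y ∧ StartsWith u x ∧ StartsWith v y := by
  obtain ⟨x, ρ, hρ, hq⟩ := hT.exists_isFinalRun q
  obtain ⟨x', y, hxy, hu, hv, -⟩ := h.exists_rel hinf hp hρ hq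
  exact ⟨x', y, hxy, hu, hv⟩

/-- The states and transition outputs of a finite run, listed by position. -/
theorem FinRun.exists_states {p q : Q} {u : List A} {v : List B} (h : T.FinRun p u v q) :
    ∃ (s : ℕ → Q) (o : ℕ → List B), s 0 = p ∧ s u.length = q ∧
      ∀ (i : ℕ) (hi : i < u.length), (s i, u[i], s (i + 1), o i) ∈ T.trans := by
  induction h with
  | nil q => exact ⟨fun _ => q, fun _ => [], rfl, rfl, fun i hi => by simp at hi⟩
  | @cons p _ _ a γ u v hpq _ ih =>
    obtain ⟨s, o, rfl, hs, hstep⟩ := ih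
    refine ⟨fun n => Nat.casesOn n p s, fun n => Nat.casesOn n γ o, rfl, hs, ?_⟩
    rintro (_ | i) hi
    · exact hpq
    · exact hstep i (by simpa using hi)

/-- Repeating a loop on an accepting state forever is a final run. -/
theorem FinRun.exists_isFinalRun_of_loop {q : Q} {u : List A} {v : List B}
    (h : T.FinRun q u v q) (hu : u ≠ []) (hq : q ∈ T.acc) :
    ∃ x ρ, T.IsFinalRun x ρ ∧ ρ.state 0 = q ∧ StartsWith u x ∧
      ∀ k, x (k + u.length) = x k := by
  obtain ⟨s, o, hs, hs', hstep⟩ := h.exists_states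
  have hlen : 0 < u.length := List.length_pos_of_ne_nil hu
  refine ⟨fun n => u[n % u.length]'(Nat.mod_lt _ hlen),
    ⟨fun n => s (n % u.length), fun n => o (n % u.length)⟩, ⟨fun n => ?_, q, hq, ?_⟩, ?_, ?_, ?_⟩
  · have hlt := Nat.mod_lt n hlen
    -- At the end of a period the index wraps to `0`, which is harmless because the loop starts and
    -- ends in `q`.
    have hn : s ((n + 1) % u.length) = s (n % u.length + 1) := by
      rcases Nat.lt_or_ge (n % u.length + 1) u.length with hlt' | hge
      · rw [Nat.add_mod, Nat.mod_eq_of_lt (show 1 < u.length by omega), Nat.mod_eq_of_lt hlt']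
      · have heq : n % u.length + 1 = u.length := by omega
        rw [← Nat.mod_add_mod, heq, Nat.mod_self, hs, hs']
    simpa only [hn] using hstep _ hlt
  · rw [Filter.frequently_atTop]
    intro n
    exact ⟨n * u.length, Nat.le_mul_of_pos_right n hlen, by simp [hs]⟩
  · simp [hs]
  · intro k hk
    simp only [Nat.mod_eq_of_lt hk]
  · intro k
    simp

/-! ### Pumping: patterns refute continuity -/

theorem le_length_append_flatten_replicate {u v : List A} (hv : v ≠ []) (n : ℕ) :
    n ≤ (u ++ (List.replicate n v).flatten).length := by
  have : 0 < v.length := List.length_pos_of_ne_nil hv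
  simp only [List.length_append, List.length_flatten, List.map_replicate, List.sum_replicate,
    smul_eq_mul]
  nlinarith

theorem flatten_replicate_nil (n : ℕ) : (List.replicate n ([] : List B)).flatten = [] := by
  simp

theorem PatternCont.not_omegaContinuous (hfun : T.Functional) (htrim : T.Trim)
    (hinf : T.FinalRunsProduceInfinite) (h : T.PatternCont) : ¬ OmegaContinuous T.toFun := by
  obtain ⟨p₁, q₁, p₂, q₂, r₂, u, v, w, u₁, v₁, u₂, v₂, w₂, hu₁, hv₁, hu₂, hv₂, hw₂, hv,
    ⟨hp₁, hp₂, hq₁⟩, hmis⟩ := h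
  obtain ⟨z, ρ, hρ, hs, hz, hper⟩ := hv₁.exists_isFinalRun_of_loop hv hq₁
  obtain ⟨x, fx, hx, hux, hu₁x, hxz⟩ := hu₁.exists_rel hinf hp₁ hρ hs
  have hxn (n : ℕ) : StartsWith (u ++ (List.replicate n v).flatten) x := by
    rw [startsWith_append]
    exact ⟨hux, by simpa only [hxz] using startsWith_flatten_replicate hz hper n⟩
  have hfx := (T.mem_toFun_iff hfun x fx).2 hx
  intro hcont
  -- Precision `u₁.length` suffices, since the mismatch is at a position of `u₁`.
  obtain ⟨n, hn⟩ := hcont x (Part.dom_iff_mem.2 ⟨fx, hfx⟩) fx hfx u₁.length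
  have key : ∃ y fy v', T.Rel y fy ∧ StartsWith (u ++ (List.replicate n v).flatten) y ∧
      StartsWith v' fy ∧ Mismatch u₁ v' := by
    rcases hmis with hmis | ⟨rfl, hmis⟩
    · obtain ⟨y, fy, hy, hyu, hyv⟩ := htrim.exists_rel hinf (hu₂.append (hv₂.iterate n)) hp₂
      exact ⟨y, fy, u₂, hy, hyu, (startsWith_append.1 hyv).1, hmis⟩
    · obtain ⟨y, fy, hy, hyu, hyv⟩ :=
        htrim.exists_rel hinf ((hu₂.append (hv₂.iterate n)).append hw₂) hp₂
      rw [flatten_replicate_nil, List.append_nil] at hyv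
      exact ⟨y, fy, u₂ ++ w₂, hy, (startsWith_append.1 hyu).1, hyv, hmis⟩
  obtain ⟨y, fy, v', hy, hyu, hyv, hmis'⟩ := key
  exact hmis'.not_agreeTo hu₁x hyv (hn y fy ((T.mem_toFun_iff hfun y fy).2 hy)
    ((hxn n).agreeTo hyu (le_length_append_flatten_replicate hv n)))

theorem PatternUCont.not_omegaUniformlyContinuous (hfun : T.Functional) (htrim : T.Trim)
    (hinf : T.FinalRunsProduceInfinite) (h : T.PatternUCont) :
    ¬ OmegaUniformlyContinuous T.toFun := by
  obtain ⟨p₁, q₁, r₁, p₂, q₂, r₂, u, v, w, w', u₁, v₁, w₁, u₂, v₂, w₂, hu₁, hv₁, hw₁,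
    hu₂, hv₂, hw₂, hv, ⟨hp₁, hp₂⟩, hmis⟩ := h
  intro hcont
  obtain ⟨n, hn⟩ := hcont (u₁ ++ w₁).length
  -- Whichever disjunct holds, both runs can be pumped with their mismatching outputs kept.
  have pump {p q r : Q} {z : List A} {a b c : List B} (ha : T.FinRun p u a q)
      (hb : T.FinRun q v b q) (hc : T.FinRun q z c r) (hp : p ∈ T.init) :
      ∃ x y, T.Rel x y ∧ StartsWith (u ++ (List.replicate n v).flatten) x ∧ StartsWith a y ∧
        (b = [] → StartsWith (a ++ c) y) := by
    obtain ⟨x, y, hxy, hx, hy⟩ :=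
      htrim.exists_rel hinf ((ha.append (hb.iterate n)).append hc) hp
    refine ⟨x, y, hxy, (startsWith_append.1 hx).1,
      (startsWith_append.1 (startsWith_append.1 hy).1).1, ?_⟩
    rintro rfl
    rwa [flatten_replicate_nil, List.append_nil] at hy
  obtain ⟨x, fx, hx, hxu, hxa, hxc⟩ := pump hu₁ hv₁ hw₁ hp₁
  obtain ⟨y, fy, hy, hyu, hya, hyc⟩ := pump hu₂ hv₂ hw₂ hp₂
  have hagree := hn x y fx ((T.mem_toFun_iff hfun x fx).2 hx) fy
    ((T.mem_toFun_iff hfun y fy).2 hy)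
    (hxu.agreeTo hyu (le_length_append_flatten_replicate hv n))
  have hagree' : AgreeTo u₁.length fx fy := fun k hk => hagree k (by simp; omega)
  rcases hmis with hmis | ⟨h₁, hmis⟩ | ⟨h₂, hmis⟩ | ⟨h₁, h₂, hmis⟩
  · exact hmis.not_agreeTo hxa hya hagree'
  · exact hmis.not_agreeTo (hxc h₁) hya hagree
  · exact hmis.not_agreeTo hxa (hyc h₂) hagree'
  · exact hmis.not_agreeTo (hxc h₁) (hyc h₂) hagree

/-! ### Pigeonhole: discontinuity yields patterns -/

/-- If the truncated output lengths of two prefixes of a run agree, then the output is already long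
or nothing is produced in between. -/
theorem _root_.InfRun.le_length_or_outSegment_eq_nil (ρ : InfRun Q B) {i m l : ℕ}
    (h : min i (ρ.outPrefix m).length = min i (ρ.outPrefix (m + l)).length) :
    i ≤ (ρ.outPrefix m).length ∨ ρ.outSegment m l = [] := by
  rw [InfRun.outPrefix_add, List.length_append] at h
  rw [← List.length_eq_zero_iff]
  omega

/-- A function on the natural numbers with finitely many values repeats a value below some bound
that depends only on the set of values. -/
theorem exists_bound_repetition (α : Type*) [Finite α] :
    ∃ N : ℕ, ∀ g : ℕ → α, ∃ k l, k < l ∧ l ≤ N ∧ g k = g l := by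
  have := Fintype.ofFinite α
  refine ⟨Fintype.card α, fun g => ?_⟩
  obtain ⟨a, b, hab, hg⟩ := Fintype.exists_ne_map_eq_of_card_lt
    (fun k : Fin (Fintype.card α + 1) => g k) (by simp)
  rcases lt_or_gt_of_ne hab with h | h
  · exact ⟨a, b, h, by omega, hg⟩
  · exact ⟨b, a, h, by omega, hg.symm⟩

theorem map_range'_congr {x y : ℕ → A} {j m l : ℕ} (h : AgreeTo j x y) (hj : m + l ≤ j) :
    (List.range' m l).map x = (List.range' m l).map y := by
  refine List.map_congr_left fun k hk => h k ?_
  rw [List.mem_range'_1] at hk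
  omega

theorem IsRun.finRun_outPrefix {x : ℕ → A} {ρ : InfRun Q B} (h : T.IsRun x ρ) (n : ℕ) :
    T.FinRun (ρ.state 0) ((List.range' 0 n).map x) (ρ.outPrefix n) (ρ.state n) := by
  rw [ρ.outPrefix_eq_outSegment]
  simpa only [Nat.zero_add] using h.finRun 0 n

theorem patternCont_of_not_omegaContinuous [Finite Q] (hfun : T.Functional)
    (h : ¬ OmegaContinuous T.toFun) : T.PatternCont := by
  simp only [OmegaContinuous, OmegaContinuousAt] at h
  push Not at h
  obtain ⟨x, -, fx, hfx, i, hi⟩ := h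
  obtain ⟨ρ, ⟨⟨hρ, q, hq, hfreq⟩, hinit⟩, hout⟩ := (T.mem_toFun_iff hfun x fx).1 hfx
  obtain ⟨n₀, hn₀⟩ := hout.1 i
  -- `φ` enumerates visits of `ρ` to `q` after `i` letters are out, so only the run on `y` needs the
  -- pigeonhole.
  obtain ⟨φ, hφ, hφq⟩ := Filter.extraction_of_frequently_atTop
    (hfreq.and_eventually (Filter.eventually_ge_atTop n₀))
  -- `N` is fixed before `y`, so that `y` can be chosen to agree with `x` over any repetition found.
  obtain ⟨N, hN⟩ := exists_bound_repetition (Q × Fin (i + 1))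
  obtain ⟨y, fy, hfy, hxy, hne⟩ := hi (φ N)
  obtain ⟨σ, ⟨⟨hσ, -⟩, hinit'⟩, hout'⟩ := (T.mem_toFun_iff hfun y fy).1 hfy
  obtain ⟨a, b, hab, hbN, heq⟩ := hN fun k =>
    (σ.state (φ k), ⟨min i (σ.outPrefix (φ k)).length, by omega⟩)
  simp only [Prod.mk.injEq, Fin.mk.injEq] at heq
  obtain ⟨hst, hlen⟩ := heq
  have hlt := hφ hab
  have hle : φ b ≤ φ N := hφ.monotone hbN
  have hqa := (hφq a).1
  have hqb := (hφq b).1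
  have hlong : i ≤ (ρ.outPrefix (φ a)).length :=
    hn₀.trans (ρ.outPrefix_isPrefix (hφq a).2).length_le
  generalize φ a = m at *
  generalize φ b = m' at *
  obtain ⟨l, rfl⟩ := Nat.exists_eq_add_of_lt hlt
  rw [Nat.add_assoc] at *
  -- This tail may leave the common prefix: the pattern asks nothing of the input `w`.
  obtain ⟨s, hs⟩ := hout'.1.exists_outSegment m i
  refine ⟨ρ.state 0, q, σ.state 0, σ.state m, σ.state (m + s), (List.range' 0 m).map x,
    (List.range' m (l + 1)).map x, (List.range' m s).map y, ρ.outPrefix m,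
    ρ.outSegment m (l + 1), σ.outPrefix m, σ.outSegment m (l + 1), σ.outSegment m s,
    ?_, ?_, ?_, ?_, hσ.finRun m s, by simp, ⟨hinit, hinit', hq⟩, ?_⟩
  · exact hqa ▸ hρ.finRun_outPrefix m
  · have := hρ.finRun m (l + 1)
    rwa [hqa, hqb] at this
  · rw [map_range'_congr hxy (by omega)]
    exact hσ.finRun_outPrefix m
  · rw [map_range'_congr hxy (by omega)]
    have := hσ.finRun m (l + 1)
    rwa [← hst] at this
  · rcases σ.le_length_or_outSegment_eq_nil hlen with hlong' | hnil
    · exact .inl (mismatch_of_not_agreeTo hne (hout.startsWith m) (hout'.startsWith m) hlong hlong')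
    · exact .inr ⟨hnil, mismatch_of_not_agreeTo hne (hout.startsWith m)
        (σ.outPrefix_add m s ▸ hout'.startsWith (m + s)) hlong hs⟩

theorem patternUCont_of_not_omegaUniformlyContinuous [Finite Q] (hfun : T.Functional)
    (h : ¬ OmegaUniformlyContinuous T.toFun) : T.PatternUCont := by
  simp only [OmegaUniformlyContinuous] at h
  push Not at h
  obtain ⟨i, hi⟩ := h
  -- Both runs now vary with the precision, so both states and both capped lengths must repeat
  -- together.
  obtain ⟨N, hN⟩ := exists_bound_repetition ((Q × Fin (i + 1)) × (Q × Fin (i + 1)))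
  obtain ⟨x, y, fx, hfx, fy, hfy, hxy, hne⟩ := hi N
  obtain ⟨ρ, ⟨⟨hρ, -⟩, hinit⟩, hout⟩ := (T.mem_toFun_iff hfun x fx).1 hfx
  obtain ⟨σ, ⟨⟨hσ, -⟩, hinit'⟩, hout'⟩ := (T.mem_toFun_iff hfun y fy).1 hfy
  obtain ⟨m, m', hlt, hle, heq⟩ := hN fun k =>
    ((ρ.state k, ⟨min i (ρ.outPrefix k).length, by omega⟩),
      (σ.state k, ⟨min i (σ.outPrefix k).length, by omega⟩))
  simp only [Prod.mk.injEq, Fin.mk.injEq] at heq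
  obtain ⟨⟨hst, hlen⟩, hst', hlen'⟩ := heq
  obtain ⟨l, rfl⟩ := Nat.exists_eq_add_of_lt hlt
  rw [Nat.add_assoc] at *
  obtain ⟨s, hs⟩ := hout.1.exists_outSegment m i
  obtain ⟨s', hs'⟩ := hout'.1.exists_outSegment m i
  refine ⟨ρ.state 0, ρ.state m, ρ.state (m + s), σ.state 0, σ.state m, σ.state (m + s'),
    (List.range' 0 m).map x, (List.range' m (l + 1)).map x, (List.range' m s).map x,
    (List.range' m s').map y, ρ.outPrefix m, ρ.outSegment m (l + 1), ρ.outSegment m s,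
    σ.outPrefix m, σ.outSegment m (l + 1), σ.outSegment m s',
    hρ.finRun_outPrefix m, ?_, hρ.finRun m s, ?_, ?_, hσ.finRun m s', by simp,
    ⟨hinit, hinit'⟩, ?_⟩
  · have := hρ.finRun m (l + 1)
    rwa [← hst] at this
  · rw [map_range'_congr hxy (by omega)]
    exact hσ.finRun_outPrefix m
  · rw [map_range'_congr hxy (by omega)]
    have := hσ.finRun m (l + 1)
    rwa [← hst'] at this
  · have hρm := hout.startsWith m
    have hσm := hout'.startsWith m
    have hρs := ρ.outPrefix_add m s ▸ hout.startsWith (m + s)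
    have hσs := σ.outPrefix_add m s' ▸ hout'.startsWith (m + s')
    rcases ρ.le_length_or_outSegment_eq_nil hlen with h₁ | h₁ <;>
      rcases σ.le_length_or_outSegment_eq_nil hlen' with h₂ | h₂
    · exact .inl (mismatch_of_not_agreeTo hne hρm hσm h₁ h₂)
    · exact .inr (.inr (.inl ⟨h₂, mismatch_of_not_agreeTo hne hρm hσs h₁ hs'⟩))
    · exact .inr (.inl ⟨h₁, mismatch_of_not_agreeTo hne hρs hσm hs h₂⟩)
    · exact .inr (.inr (.inr ⟨h₁, h₂, mismatch_of_not_agreeTo hne hρs hσs hs hs'⟩))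

end BuchiTransducer

theorem mainTheorem5 {Q A B : Type*} [Finite Q] [Finite A] [Finite B]
    (T : BuchiTransducer Q A B) (hfun : T.Functional) (htrim : T.Trim)
    (hinf : T.FinalRunsProduceInfinite) :
    (¬ OmegaContinuous T.toFun ↔ T.PatternCont) ∧
      (¬ OmegaUniformlyContinuous T.toFun ↔ T.PatternUCont) := by
  exact ⟨⟨BuchiTransducer.patternCont_of_not_omegaContinuous hfun,
      fun h => h.not_omegaContinuous hfun htrim hinf⟩,
    ⟨BuchiTransducer.patternUCont_of_not_omegaUniformlyContinuous hfun,
      fun h => h.not_omegaUniformlyContinuous hfun htrim hinf⟩⟩
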